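/- Let $n,k\ge 0$ be integers and let $q$ be either $1$ or a prime power. If $q=1$, let $V$ be a set of size $n$, call its subsets subspaces, and let the rank of a subspace be its cardinality; if $q\ge 2$, let $V$ be an $n$-dimensional vector space over the field $\mathbb{F}_q$ with $q$ elements, and let the rank of a subspace be its dimension. Let $\binom{V}{k}_q$ be the set of all subspaces of $V$ of rank $k$. For integers $m\ge 0$ put $[m]_q=1+q+\dots+q^{m-1}$ (so $[m]_1=m$), and for integers $m,j\ge 0$ put $\binom{m}{j}_q=\prod_{i=0}^{j-1}\frac{[m-i]_q}{[j-i]_q}$ for $j\le m$ and $\binom{m}{j}_q=0$ for $j>m$. For $0\le t\le\min(k,n-k)$ let $\bar V_t\subseteq\mathbb{R}^{\binom{V}{k}_q}$ be the real row space of the incidence matrix whose rows are indexed by $T\in\binom{V}{t}_q$, whose columns are indexed by $K\in\binom{V}{k}_q$, and whose $(T,K)$ entry is $1$ if $T\subseteq K$ and $0$ otherwise. The degree of a non-empty set $\mathcal{F}\subseteq\binom{V}{k}_q$ is the smallest $t\in\{0,\dots,\min(k,n-k)\}$ such that the characteristic function of $\mathcal{F}$ lies in $\bar V_t$; the empty set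 has degree $-\infty$. Let $\mathcal{F}\subseteq\binom{V}{k}_q$ be a set of degree $1$ (which forces $1\le k\le n-1$), and let \[ x=\frac{\#\mathcal{F}}{\binom{n-1}{k-1}_q} \] be its parameter. Then \[ \frac{[k]_q}{[\gcd(n,k)]_q}\cdot x\in\mathbb{Z}. \] Moreover, $[k]_q/[\gcd(n,k)]_q$ is an integer, and it is divisible by the denominator of the fraction $x$ in lowest terms. -/

import Mathlib

/-- The `q`-number `[n]_q = 1 + q + ⋯ + q ^ (n - 1)` for `n ≥ 0`;
it equals `(q ^ n - 1) / (q - 1)` for `q ≥ 2`, and `[n]_1 = n`. -/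
def qNumber (q n : ℕ) : ℕ := ∑ i ∈ Finset.range n, q ^ i

/-- The Gaussian binomial coefficient
`([n]_q [n-1]_q ⋯ [n-k+1]_q) / ([k]_q [k-1]_q ⋯ [1]_q)` for `n, k ≥ 0`. If `k > n`, then the factor
with `i = n` is `[0]_q = 0`, so the truncated differences are harmless. -/
def qBinomial (q n k : ℕ) : ℚ :=
  (∏ i ∈ Finset.range k, (qNumber q (n - i) : ℚ)) /
    ∏ i ∈ Finset.range k, (qNumber q (k - i) : ℚ)

section Degree

/- `L` is a lattice of "subspaces" with rank function `rk`. It is used in two cases: all subsets of a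
finite set, ranked by cardinality (`q = 1`), and all subspaces of a finite-dimensional vector space
over a finite field, ranked by dimension (`q ≥ 2`). -/
variable {L : Type*} [LE L] (rk : L → ℕ)

/-- The type of elements of rank `k`. -/
abbrev RankLevel (k : ℕ) : Type _ := {X : L // rk X = k}

open Classical in
/-- The `x`-versus-`y` inclusion matrix: its entry at `(X, Y)` is `1` if `X ≤ Y`, else `0`. Its row
at `X` is the characteristic function of the pencil of all `Y` of rank `y` above `X`. -/
noncomputable def inclusionMatrix (x y : ℕ) : Matrix (RankLevel rk x) (RankLevel rk y) ℝ :=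
  Matrix.of fun X Y => if X.1 ≤ Y.1 then 1 else 0

/-- The real row space of the `t`-versus-`k` inclusion matrix. -/
noncomputable def inclusionRowSpace (k t : ℕ) : Submodule ℝ (RankLevel rk k → ℝ) :=
  Submodule.span ℝ (Set.range (inclusionMatrix rk t k).row)

open Classical in
/-- The degree of a real function on the elements of rank `k`, where `n` is the rank of the ambient
space: `-∞` for the zero function, and otherwise the smallest `t ∈ {0, …, min (k, n - k)}` such that
the function lies in the row space of the `t`-versus-`k` inclusion matrix. -/
noncomputable def functionDegree (n k : ℕ) (f : RankLevel rk k → ℝ) : WithBot ℕ :=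
  if f = 0 then ⊥
  else ((sInf {t : ℕ | t ≤ min k (n - k) ∧ f ∈ inclusionRowSpace rk k t} : ℕ) : WithBot ℕ)

/-- The degree of a set of elements of rank `k` is the degree of its characteristic function. -/
noncomputable def setDegree (n k : ℕ) (F : Set (RankLevel rk k)) : WithBot ℕ :=
  functionDegree rk n k (F.indicator 1)

/-- The parameter `x = #F / [n-1, k-1]_q` of a set `F` of elements of rank `k`; it is used for sets
of degree `1` only, and these exist only for `1 ≤ k ≤ n - 1`. -/
noncomputable def degreeOneParameter (q n k : ℕ) (F : Set (RankLevel rk k)) : ℚ :=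
  (F.ncard : ℚ) / qBinomial q (n - 1) (k - 1)

end Degree

/-! A set `F` of degree 1 has a characteristic function that sums a weight over the points of `K`.
Hence any family of `k`-spaces covering every point `l` times meets `F` in `l` times the total
weight. The family of all `k`-spaces has `l = [n-1, k-1]_q`, so the total weight is the parameter
`x`, and `l * x` is an integer for every such design (`natCard_mem_mul_eq_mul_ncard`).

Write `g = gcd n k`, `n = g * m`, `k = g * s`. For sets, the blocks `Fin g × (T + a)` with `T ⊆ ZMod
m`, `#T = s`, give `l = s = k / g`, which suffices.

For vector spaces, identify `V` with a field `L` containing a field `M` of degree `g` over `𝔽`, and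
take the translates `a • W`, `a ∈ Lˣ`, of an `s`-dimensional `M`-subspace `W`. Now `l = q ^ k - 1`,
and `a • W` depends only on the coset of `a` modulo `Mˣ`, so the count is divisible by `q ^ g - 1`.
Dividing leaves `[k]_q / [g]_q * x`. -/

/-! ### Point weights and designs -/

section Weights

variable {L : Type*} [LE L] {rk : L → ℕ} {n k : ℕ}

open Classical in
/-- The characteristic function of a set of degree `1` is a sum of weights of points. -/
theorem exists_weights_of_setDegree_eq_one [Fintype (RankLevel rk 1)]
    {F : Set (RankLevel rk k)} (h : setDegree rk n k F = 1) :
    1 ≤ k ∧ k < n ∧ ∃ c : RankLevel rk 1 → ℝ,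
      ∀ K, F.indicator (1 : RankLevel rk k → ℝ) K = ∑ P, if P.1 ≤ K.1 then c P else 0 := by
  unfold setDegree functionDegree at h
  split_ifs at h with h0
  · exact absurd h (by simp)
  have h1 : sInf {t : ℕ | t ≤ min k (n - k) ∧
      F.indicator (1 : RankLevel rk k → ℝ) ∈ inclusionRowSpace rk k t} = 1 := by
    exact_mod_cast h
  -- In `ℕ` the infimum of the empty set is `0`, so the value `1` shows that the set is non-empty
  -- and the infimum attained; `1 ≤ min k (n - k)` then bounds `k`.
  have hmem := Nat.sInf_mem (s := {t : ℕ | t ≤ min k (n - k) ∧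
      F.indicator (1 : RankLevel rk k → ℝ) ∈ inclusionRowSpace rk k t})
      (Nat.nonempty_of_pos_sInf (by omega))
  rw [h1] at hmem
  obtain ⟨hle, hF⟩ := hmem
  refine ⟨by omega, by omega, ?_⟩
  obtain ⟨c, hc⟩ := (Submodule.mem_span_range_iff_exists_fun ℝ).1 hF
  refine ⟨c, fun K => ?_⟩
  rw [← hc, Finset.sum_apply]
  refine Finset.sum_congr rfl fun P _ => ?_
  simp [inclusionMatrix, Matrix.row]

open Classical in
/-- A family of elements of rank `k` that covers every point `l` times meets a weighted set in `l`
times the total weight. -/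
theorem natCard_mem_eq_mul_sum_weights [Fintype (RankLevel rk 1)] {F : Set (RankLevel rk k)}
    {c : RankLevel rk 1 → ℝ}
    (hc : ∀ K, F.indicator (1 : RankLevel rk k → ℝ) K = ∑ P, if P.1 ≤ K.1 then c P else 0)
    {A : Type*} [Finite A] (κ : A → RankLevel rk k) {l : ℕ}
    (hκ : ∀ P : RankLevel rk 1, Nat.card {a // P.1 ≤ (κ a).1} = l) :
    (Nat.card {a // κ a ∈ F} : ℝ) = l * ∑ P, c P := by
  have := Fintype.ofFinite A
  have h1 : (Nat.card {a // κ a ∈ F} : ℝ) = ∑ a, F.indicator (1 : RankLevel rk k → ℝ) (κ a) := by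
    simp [Set.indicator_apply, Fintype.card_subtype]
  rw [h1, Finset.mul_sum]
  simp_rw [hc]
  rw [Finset.sum_comm]
  refine Finset.sum_congr rfl fun P _ => ?_
  rw [← hκ P]
  simp [← Finset.sum_filter, Fintype.card_subtype]

/-- Comparing the design `κ` with the design of all elements of rank `k` eliminates the unknown real
total weight and leaves an identity in `ℕ`. -/
theorem natCard_mem_mul_eq_mul_ncard [Finite (RankLevel rk 1)] [Finite (RankLevel rk k)]
    {F : Set (RankLevel rk k)} (h : setDegree rk n k F = 1) {N l : ℕ}
    (hN : ∀ P : RankLevel rk 1, Nat.card {K : RankLevel rk k // P.1 ≤ K.1} = N)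
    {A : Type*} [Finite A] (κ : A → RankLevel rk k)
    (hκ : ∀ P : RankLevel rk 1, Nat.card {a // P.1 ≤ (κ a).1} = l) :
    Nat.card {a // κ a ∈ F} * N = l * F.ncard := by
  have := Fintype.ofFinite (RankLevel rk 1)
  obtain ⟨-, -, c, hc⟩ := exists_weights_of_setDegree_eq_one h
  have h1 := natCard_mem_eq_mul_sum_weights hc κ hκ
  have h2 := natCard_mem_eq_mul_sum_weights hc id hN
  have h3 : Nat.card {K // id K ∈ F} = F.ncard := Nat.card_coe_set_eq F
  rw [h3] at h2
  have : (Nat.card {a // κ a ∈ F} * N : ℝ) = l * F.ncard := by rw [h1, h2]; ring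
  exact_mod_cast this

end Weights

/-! ### Arithmetic of `q`-numbers and Gaussian binomials -/

section QNumbers

theorem qNumber_pos (q : ℕ) {n : ℕ} (hn : 0 < n) : 0 < qNumber q n := by
  obtain ⟨m, rfl⟩ := Nat.exists_eq_add_of_lt hn
  rw [qNumber, zero_add, Finset.sum_range_succ']
  positivity

theorem qNumber_one (n : ℕ) : qNumber 1 n = n := by simp [qNumber]

theorem sub_one_mul_qNumber {q : ℕ} (hq : 1 ≤ q) (n : ℕ) : (q - 1) * qNumber q n = q ^ n - 1 := by
  rw [mul_comm]
  exact geom_sum_mul_of_one_le hq n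

theorem qNumber_mul (q g m : ℕ) : qNumber q (g * m) = qNumber q g * qNumber (q ^ g) m := by
  induction m with
  | zero => simp [qNumber]
  | succ m ih =>
    have h : qNumber q (g * (m + 1)) = qNumber q (g * m) + q ^ (g * m) * qNumber q g := by
      simp only [qNumber, Nat.mul_succ, Finset.sum_range_add, pow_add, Finset.mul_sum]
    have h' : qNumber (q ^ g) (m + 1) = qNumber (q ^ g) m + (q ^ g) ^ m := by
      simp [qNumber, Finset.sum_range_succ]
    rw [h, h', ih, pow_mul]
    ring

theorem qNumber_dvd_qNumber (q : ℕ) {g k : ℕ} (h : g ∣ k) : qNumber q g ∣ qNumber q k := by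
  obtain ⟨m, rfl⟩ := h
  exact ⟨_, qNumber_mul q g m⟩

theorem qBinomial_pos (q : ℕ) {n k : ℕ} (h : k ≤ n) : 0 < qBinomial q n k := by
  refine div_pos (Finset.prod_pos fun i hi => ?_) (Finset.prod_pos fun i hi => ?_) <;>
  · rw [Finset.mem_range] at hi
    exact_mod_cast qNumber_pos q (by omega)

theorem qBinomial_zero_right (q n : ℕ) : qBinomial q n 0 = 1 := by simp [qBinomial]

theorem qBinomial_succ_right (q n k : ℕ) :
    qBinomial q n (k + 1) = qNumber q n / qNumber q (k + 1) * qBinomial q (n - 1) k := by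
  have h : ∀ m i : ℕ, m - (i + 1) = m - 1 - i := by omega
  have h' : ∀ m : ℕ, ∏ i ∈ Finset.range (k + 1), (qNumber q (m - i) : ℚ) =
      qNumber q m * ∏ i ∈ Finset.range k, (qNumber q (m - 1 - i) : ℚ) := fun m => by
    rw [Finset.prod_range_succ', mul_comm]
    exact congrArg _ (Finset.prod_congr rfl fun i _ => by rw [h])
  rw [qBinomial, h', h', qBinomial, div_mul_div_comm, Nat.add_sub_cancel]

theorem qBinomial_one (n k : ℕ) : qBinomial 1 n k = n.choose k := by
  induction k generalizing n with
  | zero => simp [qBinomial_zero_right]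
  | succ k ih =>
    rw [qBinomial_succ_right, ih, qNumber_one, qNumber_one]
    cases n with
    | zero => simp
    | succ n =>
      rw [div_mul_eq_mul_div, div_eq_iff (by positivity)]
      exact_mod_cast Nat.add_one_mul_choose_eq n k

/-- With `r = a / b` an integer, `x = z / r`, so the reduced denominator divides `r`. -/
theorem den_mul_dvd_of_div_mul_eq {a b : ℕ} (hb : 0 < b) (ha : 0 < a) (hba : b ∣ a) {x : ℚ} {z : ℤ}
    (h : (a : ℚ) / b * x = z) : x.den * b ∣ a := by
  obtain ⟨r, rfl⟩ := hba
  have hr : 0 < r := Nat.pos_of_mul_pos_left ha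
  have hb' : (b : ℚ) ≠ 0 := by positivity
  have hr' : (r : ℚ) ≠ 0 := by positivity
  have hx : x = (z : ℚ) / (r : ℤ) := by
    rw [Nat.cast_mul, mul_div_cancel_left₀ _ hb'] at h
    rw [← h, Int.cast_natCast, mul_div_cancel_left₀ _ hr']
  rw [mul_comm b]
  refine Nat.mul_dvd_mul_right ?_ b
  have := Rat.den_dvd z r
  rw [Rat.divInt_eq_div, ← hx] at this
  exact_mod_cast this

end QNumbers

/-- Common last step of both cases: the integer sought is the `m` of the counting identity. -/
theorem degreeOneParameter_integrality {L : Type*} {rk : L → ℕ} {q n k : ℕ} (hk : 0 < k)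
    (hkn : k ≤ n) (F : Set (RankLevel rk k)) {N m : ℕ}
    (hN : (N : ℚ) = qBinomial q (n - 1) (k - 1))
    (hm : m * N * qNumber q (n.gcd k) = qNumber q k * F.ncard) :
    (∃ z : ℤ, ((qNumber q k : ℚ) / (qNumber q (Nat.gcd n k) : ℚ)) *
        degreeOneParameter rk q n k F = z) ∧
      (degreeOneParameter rk q n k F).den * qNumber q (Nat.gcd n k) ∣ qNumber q k := by
  have hg := qNumber_pos q (Nat.gcd_pos_of_pos_right n hk)
  have hN0 : (N : ℚ) ≠ 0 := by
    rw [hN]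
    exact (qBinomial_pos q (by omega)).ne'
  have key : ((qNumber q k : ℚ) / (qNumber q (Nat.gcd n k) : ℚ)) *
      degreeOneParameter rk q n k F = (m : ℤ) := by
    have hg' : (qNumber q (n.gcd k) : ℚ) ≠ 0 := by positivity
    have hm' : (m * N * qNumber q (n.gcd k) : ℚ) = qNumber q k * F.ncard := by exact_mod_cast hm
    rw [degreeOneParameter, ← hN, div_mul_div_comm, ← hm', Int.cast_natCast]
    field_simp
  exact ⟨⟨m, key⟩, den_mul_dvd_of_div_mul_eq hg (qNumber_pos q hk)
    (qNumber_dvd_qNumber q (Nat.gcd_dvd_right n k)) key⟩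

/-! ### The case `q = 1`: a cyclic design -/

section Sets

variable {V : Type*} [Fintype V] {k : ℕ}

theorem natCard_finset_ge_point (hk : 0 < k)
    (P : RankLevel (fun X : Finset V => X.card) 1) :
    Nat.card {K : RankLevel (fun X : Finset V => X.card) k // P.1 ≤ K.1} =
      (Fintype.card V - 1).choose (k - 1) := by
  classical
  have hP : P.1.card = 1 := P.2
  rw [Nat.card_congr (Equiv.subtypeSubtypeEquivSubtypeInter
    (fun X : Finset V => X.card = k) (fun X => P.1 ≤ X)),
    Nat.subtype_card ((Finset.univ.powersetCard k).filter (P.1 ⊆ ·))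
      (fun X => by simp [Finset.mem_powersetCard]),
    Finset.card_filter_powersetCard_subset _ _ _ (Finset.subset_univ _) (by omega), hP,
    Finset.card_univ]

/-- The translates of `Fin g × T`, `T ⊆ ZMod m`, form a design in which every point lies
on `s` blocks. -/
theorem exists_finset_design {g m s : ℕ} [NeZero m] (hV : Fintype.card V = g * m) (hs : s ≤ m) :
    ∃ κ : ZMod m → RankLevel (fun X : Finset V => X.card) (g * s),
      ∀ P : RankLevel (fun X : Finset V => X.card) 1, Nat.card {a // P.1 ≤ (κ a).1} = s := by
  classical
  let e : V ≃ Fin g × ZMod m := Fintype.equivOfCardEq (by simp [hV, ZMod.card])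
  obtain ⟨T, -, hT⟩ := Finset.exists_subset_card_eq (s := (Finset.univ : Finset (ZMod m)))
    (n := s) (by simpa [ZMod.card] using hs)
  refine ⟨fun a => ⟨((Finset.univ : Finset (Fin g)) ×ˢ
    T.map (Equiv.addRight a).toEmbedding).map e.symm.toEmbedding, by simp [hT]⟩, fun P => ?_⟩
  obtain ⟨v, hv⟩ := Finset.card_eq_one.1 P.2
  have hiff : ∀ a : ZMod m, P.1 ≤ ((Finset.univ : Finset (Fin g)) ×ˢ
      T.map (Equiv.addRight a).toEmbedding).map e.symm.toEmbedding ↔ (e v).2 - a ∈ T := by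
    intro a
    rw [hv, Finset.singleton_subset_iff, Finset.mem_map_equiv]
    simp [Finset.mem_map_equiv, sub_eq_add_neg]
  -- The shift `a` runs through `ZMod m` exactly as `(e v).2 - a` does, so each point is hit `#T`
  -- times.
  rw [Nat.card_congr ((Equiv.subLeft (e v).2).subtypeEquiv (q := (· ∈ T)) hiff)]
  simp [hT]

theorem degreeOneParameter_integrality_finset (F : Set (RankLevel (fun X : Finset V => X.card) k))
    {n : ℕ} (hn : Fintype.card V = n)
    (h : setDegree (fun X : Finset V => X.card) n k F = 1) :
    (∃ z : ℤ, ((qNumber 1 k : ℚ) / (qNumber 1 (Nat.gcd n k) : ℚ)) *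
        degreeOneParameter (fun X : Finset V => X.card) 1 n k F = z) ∧
      (degreeOneParameter (fun X : Finset V => X.card) 1 n k F).den *
        qNumber 1 (Nat.gcd n k) ∣ qNumber 1 k := by
  classical
  obtain ⟨hk, hkn, -⟩ := exists_weights_of_setDegree_eq_one h
  obtain ⟨m, hm⟩ := Nat.gcd_dvd_left n k
  obtain ⟨s, hs⟩ := Nat.gcd_dvd_right n k
  have hg : 0 < n.gcd k := Nat.gcd_pos_of_pos_right n hk
  -- The gcd itself mentions `k`, so it must become a variable before `k = g * s` can be
  -- substituted.
  generalize hgdef : n.gcd k = g at *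
  subst hs
  have : NeZero m := ⟨by rintro rfl; omega⟩
  obtain ⟨κ, hκ⟩ := exists_finset_design (V := V) (g := g) (m := m) (s := s) (hn.trans hm)
    (Nat.le_of_mul_le_mul_left (by omega) hg)
  have hN := natCard_finset_ge_point (V := V) hk
  have key := natCard_mem_mul_eq_mul_ncard h hN κ hκ
  have res := degreeOneParameter_integrality (q := 1) hk hkn.le F (m := Nat.card {a // κ a ∈ F})
    (by rw [qBinomial_one, ← hn]) (by rw [key, hgdef, qNumber_one, qNumber_one]; ring)
  rwa [hgdef] at res

end Sets

/-! ### Counting subspaces; cosets -/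

section Subspaces

open Module

variable {𝔽 : Type*} [Field 𝔽] {V : Type*} [AddCommGroup V] [Module 𝔽 V]

theorem finrank_comap_mkQ [FiniteDimensional 𝔽 V] (P : Submodule 𝔽 V) (W : Submodule 𝔽 (V ⧸ P)) :
    finrank 𝔽 (W.comap P.mkQ) = finrank 𝔽 W + finrank 𝔽 P := by
  have h1 := (Submodule.quotientQuotientEquivQuotient P (W.comap P.mkQ)
    (P.le_comap_mkQ W)).finrank_eq
  rw [Submodule.map_comap_eq_self (by simp)] at h1
  have h2 := Submodule.finrank_quotient_add_finrank W
  have h3 := Submodule.finrank_quotient_add_finrank P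
  have h4 := Submodule.finrank_quotient_add_finrank (W.comap P.mkQ)
  omega

theorem natCard_submodule_ge_point [FiniteDimensional 𝔽 V] (k : ℕ) {P : Submodule 𝔽 V}
    (hP : finrank 𝔽 P = 1) :
    Nat.card {K : RankLevel (fun X : Submodule 𝔽 V => finrank 𝔽 X) (k + 1) // P ≤ K.1} =
      Nat.card (RankLevel (fun X : Submodule 𝔽 (V ⧸ P) => finrank 𝔽 X) k) := by
  refine (Nat.card_eq_of_bijective
    (fun W : RankLevel (fun X : Submodule 𝔽 (V ⧸ P) => finrank 𝔽 X) k =>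
      (⟨⟨W.1.comap P.mkQ, by simp only [finrank_comap_mkQ, hP, W.2]⟩, P.le_comap_mkQ W.1⟩ :
        {K : RankLevel (fun X : Submodule 𝔽 V => finrank 𝔽 X) (k + 1) // P ≤ K.1}))
    ⟨fun W W' h => ?_, fun K => ?_⟩).symm
  · refine Subtype.ext (Submodule.comap_injective_of_surjective P.mkQ_surjective ?_)
    exact congrArg (fun K => K.1.1) h
  · have hK : (K.1.1.map P.mkQ).comap P.mkQ = K.1.1 := by
      rw [Submodule.comap_map_mkQ, sup_eq_right.2 K.2]
    refine ⟨⟨K.1.1.map P.mkQ, ?_⟩, Subtype.ext (Subtype.ext hK)⟩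
    have h := finrank_comap_mkQ P (K.1.1.map P.mkQ)
    rw [hK, hP] at h
    have := K.1.2
    simp only at this ⊢
    omega

theorem natCard_nonzero_mem [Finite 𝔽] [FiniteDimensional 𝔽 V] (K : Submodule 𝔽 V) :
    Nat.card {v : V // v ∈ K ∧ v ≠ 0} = Nat.card 𝔽 ^ finrank 𝔽 K - 1 := by
  have : Finite V := Module.finite_of_finite 𝔽
  have h1 : Nat.card {v : V // v ∈ K ∧ v ≠ 0} = ((K : Set V) \ {0}).ncard := rfl
  rw [h1, Set.ncard_sdiff_singleton_of_mem K.zero_mem, ← Nat.card_coe_set_eq]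
  congr 1
  exact Module.natCard_eq_pow_finrank (K := 𝔽) (V := K)

/-- The number of subspaces of dimension `k` is a Gaussian binomial coefficient. -/
theorem natCard_submodule_rankLevel [Finite 𝔽] (k : ℕ) :
    ∀ (V : Type*) [AddCommGroup V] [Module 𝔽 V] [FiniteDimensional 𝔽 V],
    (Nat.card (RankLevel (fun X : Submodule 𝔽 V => finrank 𝔽 X) k) : ℚ) =
      qBinomial (Nat.card 𝔽) (finrank 𝔽 V) k := by
  classical
  induction k with
  | zero =>
    intro V _ _ _
    rw [qBinomial_zero_right]
    have : Unique (RankLevel (fun X : Submodule 𝔽 V => finrank 𝔽 X) 0) :=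
      { default := ⟨⊥, finrank_bot 𝔽 V⟩
        uniq := fun X => Subtype.ext (Submodule.finrank_eq_zero.1 X.2) }
    simp
  | succ k ih =>
    intro V _ _ _
    have : Finite V := Module.finite_of_finite 𝔽
    have : Finite (Submodule 𝔽 V) := Finite.of_injective _ SetLike.coe_injective
    have := Fintype.ofFinite V
    have := Fintype.ofFinite (RankLevel (fun X : Submodule 𝔽 V => finrank 𝔽 X) (k + 1))
    set q := Nat.card 𝔽 with hq
    have hq1 : 1 < q := Finite.one_lt_card
    -- Double count the pairs of a `(k + 1)`-space and a non-zero vector in it; the spaces through a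
    -- vector are counted in the quotient by its span.
    have hcount := Finset.sum_card_bipartiteAbove_eq_sum_card_bipartiteBelow
      (s := (Finset.univ : Finset (RankLevel (fun X : Submodule 𝔽 V => finrank 𝔽 X) (k + 1))))
      (t := (Finset.univ : Finset V).filter (· ≠ 0)) (fun K v => v ∈ K.1)
    have hl : ∀ K : RankLevel (fun X : Submodule 𝔽 V => finrank 𝔽 X) (k + 1),
        ((((Finset.univ : Finset V).filter (· ≠ 0)).bipartiteAbove (fun K v => v ∈ K.1) K).card : ℚ)
          = (q - 1) * qNumber q (k + 1) := by
      intro K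
      have h1 := natCard_nonzero_mem K.1
      rw [Nat.subtype_card (((Finset.univ : Finset V).filter (· ≠ 0)).bipartiteAbove
        (fun K v => v ∈ K.1) K) (fun v => by simp [Finset.bipartiteAbove, and_comm])] at h1
      have hK : finrank 𝔽 K.1 = k + 1 := K.2
      rw [h1, hK, ← hq, ← sub_one_mul_qNumber hq1.le]
      push_cast [hq1.le]
      ring
    have hr : ∀ v ∈ (Finset.univ : Finset V).filter (· ≠ 0),
        (((Finset.univ : Finset (RankLevel (fun X : Submodule 𝔽 V => finrank 𝔽 X)
          (k + 1))).bipartiteBelow (fun K v => v ∈ K.1) v).card : ℚ) =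
          qBinomial q (finrank 𝔽 V - 1) k := by
      intro v hv
      have hv0 : v ≠ 0 := by simpa using hv
      have hP : finrank 𝔽 (𝔽 ∙ v) = 1 := finrank_span_singleton hv0
      have h1 := natCard_submodule_ge_point k hP
      rw [Nat.subtype_card ((Finset.univ : Finset (RankLevel (fun X : Submodule 𝔽 V => finrank 𝔽 X)
          (k + 1))).bipartiteBelow (fun K v => v ∈ K.1) v)
          (fun K => by simp [Finset.bipartiteBelow])] at h1
      have h2 := Submodule.finrank_quotient_add_finrank (𝔽 ∙ v)
      rw [h1, ih, show finrank 𝔽 (V ⧸ 𝔽 ∙ v) = finrank 𝔽 V - 1 by omega]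
    have hV : (((Finset.univ : Finset V).filter (· ≠ 0)).card : ℚ) =
        (q - 1) * qNumber q (finrank 𝔽 V) := by
      have h1 := natCard_nonzero_mem (⊤ : Submodule 𝔽 V)
      rw [Nat.subtype_card ((Finset.univ : Finset V).filter (· ≠ 0)) (fun v => by simp),
        finrank_top, ← hq, ← sub_one_mul_qNumber hq1.le] at h1
      rw [h1]
      push_cast [hq1.le]
      ring
    have hcount' := congrArg (Nat.cast : ℕ → ℚ) hcount
    push_cast at hcount'
    rw [Finset.sum_congr rfl hr, Finset.sum_congr rfl (fun K _ => hl K), Finset.sum_const,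
      Finset.sum_const, nsmul_eq_mul, nsmul_eq_mul, hV, Finset.card_univ,
      ← Nat.card_eq_fintype_card] at hcount'
    have hq0 : (q - 1 : ℚ) ≠ 0 := by
      have : (1 : ℚ) < q := by exact_mod_cast hq1
      linarith
    have hk0 : (qNumber q (k + 1) : ℚ) ≠ 0 := by
      exact_mod_cast (qNumber_pos q k.succ_pos).ne'
    rw [qBinomial_succ_right, div_mul_eq_mul_div, eq_div_iff hk0]
    refine mul_left_cancel₀ hq0 ?_
    linear_combination hcount'

/-- A subset of a finite group that is stable under right multiplication by a subgroup has
cardinality divisible by that of the subgroup. -/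
theorem natCard_subgroup_dvd_of_stable {G : Type*} [Group G] (H : Subgroup G) (A : Set G)
    (hA : ∀ a ∈ A, ∀ h ∈ H, a * h ∈ A) : Nat.card H ∣ Nat.card A := by
  have h : A = QuotientGroup.mk ⁻¹' ((QuotientGroup.mk : G → G ⧸ H) '' A) := by
    refine Set.Subset.antisymm (Set.subset_preimage_image _ _) ?_
    rintro b ⟨a, ha, hab⟩
    have := hA a ha _ (QuotientGroup.eq.1 hab)
    rwa [mul_inv_cancel_left] at this
  rw [h, Nat.card_congr (QuotientGroup.preimageMkEquivSubgroupProdSet H _), Nat.card_prod]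
  exact dvd_mul_right _ _

theorem exists_submodule_finrank_eq_of_le {M L : Type*} [Field M] [AddCommGroup L] [Module M L]
    [FiniteDimensional M L] {s : ℕ} (hs : s ≤ finrank M L) :
    ∃ W : Submodule M L, finrank M W = s := by
  obtain ⟨f, hf⟩ := (finrank_le_iff_exists_linearMap (R := M) (M := Fin s → M)
    (M' := L)).1 (by simpa using hs)
  exact ⟨LinearMap.range f, by simp [LinearMap.finrank_range_of_inj hf]⟩

end Subspaces

/-! ### The vector space case: a design from field multiplication -/

section FieldDesign

open Module

variable {𝔽 : Type*} [Field 𝔽] {V : Type*} [AddCommGroup V] [Module 𝔽 V]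

/-- The units of a field act simply transitively on its non-zero elements, so `a ↦ a⁻¹ • y` is the
bijection. -/
theorem natCard_units_inv_smul_mem {L : Type*} [Field L] (W : Set L) {y : L} (hy : y ≠ 0) :
    Nat.card {a : Lˣ // a⁻¹ • y ∈ W} = Nat.card {w : L // w ∈ W ∧ w ≠ 0} := by
  refine Nat.card_eq_of_bijective
    (fun a => ⟨a.1⁻¹ • y, a.2, (smul_ne_zero_iff_ne _).2 hy⟩) ⟨fun a b h => ?_, fun w => ?_⟩
  · have h' : a.1⁻¹ • y = b.1⁻¹ • y := congrArg Subtype.val h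
    simp only [Units.smul_def, smul_eq_mul] at h'
    exact Subtype.ext (inv_injective (Units.ext (mul_right_cancel₀ hy h')))
  · have hw : (((Units.mk0 y hy) * (Units.mk0 w.1 w.2.2)⁻¹)⁻¹ : Lˣ) • y = w.1 := by
      simp [Units.smul_def, hy]
    exact ⟨⟨Units.mk0 y hy * (Units.mk0 w.1 w.2.2)⁻¹, by rw [hw]; exact w.2.1⟩, Subtype.ext hw⟩

/-- The image of a subspace of a field extension `L` under multiplication by a unit, transported to
a vector space isomorphic to `L`. -/
noncomputable def unitTranslate {L : Type*} [Field L] [Algebra 𝔽 L] (e : L ≃ₗ[𝔽] V)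
    (W : Submodule 𝔽 L) (a : Lˣ) : Submodule 𝔽 V :=
  W.map ((DistribMulAction.toLinearEquiv 𝔽 L a).trans e : L →ₗ[𝔽] V)

section

variable {L : Type*} [Field L] [Algebra 𝔽 L] (e : L ≃ₗ[𝔽] V) (W : Submodule 𝔽 L)

theorem finrank_unitTranslate (a : Lˣ) : finrank 𝔽 (unitTranslate e W a) = finrank 𝔽 W :=
  LinearEquiv.finrank_map_eq _ _

theorem mem_unitTranslate {a : Lˣ} {v : V} : v ∈ unitTranslate e W a ↔ a⁻¹ • e.symm v ∈ W :=
  Submodule.mem_map_equiv _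

theorem natCard_point_le_unitTranslate [Finite 𝔽] [FiniteDimensional 𝔽 L] {P : Submodule 𝔽 V}
    (hP : finrank 𝔽 P = 1) :
    Nat.card {a : Lˣ // P ≤ unitTranslate e W a} = Nat.card 𝔽 ^ finrank 𝔽 W - 1 := by
  obtain ⟨v, hv0, rfl⟩ : ∃ v : V, v ≠ 0 ∧ P = 𝔽 ∙ v := by
    obtain ⟨v, hv0, hv⟩ := finrank_eq_one_iff'.1 hP
    refine ⟨v, by simpa using hv0, le_antisymm (fun w hw => ?_)
      ((Submodule.span_singleton_le_iff_mem _ _).2 v.2)⟩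
    obtain ⟨c, hc⟩ := hv ⟨w, hw⟩
    exact Submodule.mem_span_singleton.2 ⟨c, congrArg Subtype.val hc⟩
  have hy : e.symm v ≠ 0 := by simpa using hv0
  rw [← natCard_nonzero_mem W]
  refine Eq.trans ?_ (natCard_units_inv_smul_mem (W : Set L) hy)
  refine Nat.card_congr (Equiv.subtypeEquivRight fun a => ?_)
  rw [Submodule.span_singleton_le_iff_mem, mem_unitTranslate]
  rfl

end

/-- Multiplication by a unit of `M` preserves every `M`-subspace; this is the source of the factor
`q ^ g - 1`. -/
theorem unitTranslate_mul_unitsMap {M L : Type*} [Field M] [Field L] [Algebra 𝔽 M] [Algebra M L]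
    [Algebra 𝔽 L] [IsScalarTower 𝔽 M L] (e : L ≃ₗ[𝔽] V) (W : Submodule M L) (a : Lˣ) (b : Mˣ) :
    unitTranslate e (W.restrictScalars 𝔽) (a * Units.map (algebraMap M L).toMonoidHom b) =
      unitTranslate e (W.restrictScalars 𝔽) a := by
  ext v
  simp only [mem_unitTranslate, Submodule.restrictScalars_mem]
  have h : (a * Units.map (algebraMap M L).toMonoidHom b)⁻¹ • e.symm v =
      (b⁻¹ : Mˣ) • (a⁻¹ • e.symm v) := by
    rw [mul_inv_rev, mul_smul, ← map_inv]
    simp [Units.smul_def, Algebra.smul_def]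
  rw [h]
  exact Submodule.smul_mem_iff' W b⁻¹

/-- The translates of a `k`-space over the intermediate field of degree `g` form a design, in which
the blocks belonging to a given set are indexed by a union of cosets of the units of that field. -/
theorem exists_mul_eq_of_setDegree_eq_one [Finite 𝔽] [FiniteDimensional 𝔽 V] {n g m s N : ℕ}
    [NeZero g] [NeZero m] (hV : finrank 𝔽 V = g * m) (hs : s ≤ m)
    {F : Set (RankLevel (fun X : Submodule 𝔽 V => finrank 𝔽 X) (g * s))}
    (h : setDegree (fun X : Submodule 𝔽 V => finrank 𝔽 X) n (g * s) F = 1)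
    (hN : ∀ P : RankLevel (fun X : Submodule 𝔽 V => finrank 𝔽 X) 1,
      Nat.card {K : RankLevel (fun X : Submodule 𝔽 V => finrank 𝔽 X) (g * s) // P.1 ≤ K.1} = N) :
    ∃ t : ℕ, t * N * qNumber (Nat.card 𝔽) g = qNumber (Nat.card 𝔽) (g * s) * F.ncard := by
  obtain ⟨p, _⟩ := CharP.exists 𝔽
  have : Fact p.Prime := ⟨CharP.char_is_prime 𝔽 p⟩
  let M := FiniteField.Extension 𝔽 p g
  have : CharP M p := charP_of_injective_algebraMap (algebraMap 𝔽 M).injective p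
  let L := FiniteField.Extension M p m
  let _ : Algebra 𝔽 L := ((algebraMap M L).comp (algebraMap 𝔽 M)).toAlgebra
  have : IsScalarTower 𝔽 M L := .of_algebraMap_eq' rfl
  have hM : finrank 𝔽 M = g := FiniteField.finrank_extension 𝔽 p g
  have hL : finrank M L = m := FiniteField.finrank_extension M p m
  have : FiniteDimensional 𝔽 L := .of_finite
  have hFL : finrank 𝔽 L = g * m := by rw [← finrank_mul_finrank 𝔽 M L, hM, hL]
  let e : L ≃ₗ[𝔽] V := LinearEquiv.ofFinrankEq L V (hFL.trans hV.symm)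
  obtain ⟨W, hW⟩ := exists_submodule_finrank_eq_of_le (M := M) (L := L) (hs.trans_eq hL.symm)
  have hW' : finrank 𝔽 (W.restrictScalars 𝔽) = g * s := by
    have h1 := finrank_mul_finrank 𝔽 M W
    rw [hM, hW] at h1
    exact h1.symm
  have : Finite V := Module.finite_of_finite 𝔽
  have : Finite (Submodule 𝔽 V) := Finite.of_injective _ SetLike.coe_injective
  let κ : Lˣ → RankLevel (fun X : Submodule 𝔽 V => finrank 𝔽 X) (g * s) := fun a =>
    ⟨unitTranslate e (W.restrictScalars 𝔽) a, (finrank_unitTranslate e _ a).trans hW'⟩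
  have key := natCard_mem_mul_eq_mul_ncard h hN κ (l := Nat.card 𝔽 ^ (g * s) - 1) (fun P =>
    (natCard_point_le_unitTranslate e _ P.2).trans (by rw [hW']))
  have hdvd := natCard_subgroup_dvd_of_stable (Units.map (algebraMap M L).toMonoidHom).range
    {a | κ a ∈ F} (by
      rintro a ha _ ⟨b, rfl⟩
      have : κ (a * Units.map (algebraMap M L).toMonoidHom b) = κ a :=
        Subtype.ext (unitTranslate_mul_unitsMap e W a b)
      change κ _ ∈ F
      rwa [this])
  have hH : Nat.card (Units.map (algebraMap M L).toMonoidHom).range = Nat.card 𝔽 ^ g - 1 := by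
    rw [← Nat.card_congr (MonoidHom.ofInjective
      (Units.map_injective (algebraMap M L).injective)).toEquiv, Nat.card_units,
      FiniteField.natCard_extension]
  obtain ⟨t, ht⟩ := hdvd
  have hq : 1 < Nat.card 𝔽 := Finite.one_lt_card
  -- Multiplying by `q - 1` turns the `q`-numbers into `q ^ g - 1` and `q ^ (g * s) - 1`, the sizes
  -- that occur in the design.
  refine ⟨t, Nat.eq_of_mul_eq_mul_left (Nat.sub_pos_of_lt hq) ?_⟩
  rw [← mul_assoc (Nat.card 𝔽 - 1) (qNumber _ (g * s)), sub_one_mul_qNumber hq.le, ← key]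
  change _ = Nat.card {a | κ a ∈ F} * N
  rw [ht, hH, ← sub_one_mul_qNumber hq.le]
  ring

theorem degreeOneParameter_integrality_submodule [Finite 𝔽] [FiniteDimensional 𝔽 V] {n k : ℕ}
    (hn : finrank 𝔽 V = n) (F : Set (RankLevel (fun X : Submodule 𝔽 V => finrank 𝔽 X) k))
    (h : setDegree (fun X : Submodule 𝔽 V => finrank 𝔽 X) n k F = 1) :
    (∃ z : ℤ, ((qNumber (Nat.card 𝔽) k : ℚ) / (qNumber (Nat.card 𝔽) (Nat.gcd n k) : ℚ)) *
        degreeOneParameter (fun X : Submodule 𝔽 V => finrank 𝔽 X) (Nat.card 𝔽) n k F = z) ∧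
      (degreeOneParameter (fun X : Submodule 𝔽 V => finrank 𝔽 X) (Nat.card 𝔽) n k F).den *
        qNumber (Nat.card 𝔽) (Nat.gcd n k) ∣ qNumber (Nat.card 𝔽) k := by
  have : Finite V := Module.finite_of_finite 𝔽
  have : Finite (Submodule 𝔽 V) := Finite.of_injective _ SetLike.coe_injective
  have := Fintype.ofFinite (RankLevel (fun X : Submodule 𝔽 V => finrank 𝔽 X) 1)
  obtain ⟨hk, hkn, -⟩ := exists_weights_of_setDegree_eq_one h
  obtain ⟨N, hNq, hN⟩ : ∃ N : ℕ, (N : ℚ) = qBinomial (Nat.card 𝔽) (n - 1) (k - 1) ∧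
      ∀ P : RankLevel (fun X : Submodule 𝔽 V => finrank 𝔽 X) 1,
        Nat.card {K : RankLevel (fun X : Submodule 𝔽 V => finrank 𝔽 X) k // P.1 ≤ K.1} = N := by
    obtain ⟨k, rfl⟩ := Nat.exists_eq_add_of_le' hk
    have hpt : ∀ P : RankLevel (fun X : Submodule 𝔽 V => finrank 𝔽 X) 1,
        (Nat.card {K : RankLevel (fun X : Submodule 𝔽 V => finrank 𝔽 X) (k + 1) // P.1 ≤ K.1} : ℚ)
          = qBinomial (Nat.card 𝔽) (n - 1) k := by
      intro P
      have h1 := Submodule.finrank_quotient_add_finrank P.1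
      have h2 : finrank 𝔽 P.1 = 1 := P.2
      rw [natCard_submodule_ge_point k P.2, natCard_submodule_rankLevel,
        show finrank 𝔽 (V ⧸ P.1) = n - 1 by omega]
    -- The Gaussian binomial is only known as a rational; the count at one point `U` supplies the
    -- natural number `N`.
    obtain ⟨U, hU⟩ := exists_submodule_finrank_eq_of_le (M := 𝔽) (L := V) (s := 1) (by omega)
    exact ⟨_, hpt ⟨U, hU⟩, fun P => by exact_mod_cast (hpt P).trans (hpt ⟨U, hU⟩).symm⟩
  obtain ⟨m, hm⟩ := Nat.gcd_dvd_left n k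
  obtain ⟨s, hs⟩ := Nat.gcd_dvd_right n k
  have hg : 0 < n.gcd k := Nat.gcd_pos_of_pos_right n hk
  have hmain : ∃ t : ℕ, t * N * qNumber (Nat.card 𝔽) (n.gcd k) =
      qNumber (Nat.card 𝔽) k * F.ncard := by
    generalize n.gcd k = g at *
    subst hs
    have : NeZero g := ⟨hg.ne'⟩
    have : NeZero m := ⟨by rintro rfl; omega⟩
    exact exists_mul_eq_of_setDegree_eq_one (hn.trans hm)
      (Nat.le_of_mul_le_mul_left (by omega) hg) h hN
  obtain ⟨t, ht⟩ := hmain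
  exact degreeOneParameter_integrality hk hkn.le F hNq ht

end FieldDesign

theorem corollary4p9 (q n k : ℕ) :
    -- the set case `q = 1`
    (q = 1 → ∀ (V : Type*) [Fintype V], Fintype.card V = n →
      ∀ F : Set (RankLevel (fun X : Finset V => X.card) k),
        setDegree (fun X : Finset V => X.card) n k F = 1 →
        (∃ z : ℤ, ((qNumber q k : ℚ) / (qNumber q (Nat.gcd n k) : ℚ)) *
            degreeOneParameter (fun X : Finset V => X.card) q n k F = z) ∧
          (degreeOneParameter (fun X : Finset V => X.card) q n k F).den *
            qNumber q (Nat.gcd n k) ∣ qNumber q k) ∧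
    -- the case of subspaces of a vector space over the field with `q` elements
    (∀ (𝔽 : Type*) [Field 𝔽] [Finite 𝔽] (V : Type*) [AddCommGroup V] [Module 𝔽 V]
      [FiniteDimensional 𝔽 V], Nat.card 𝔽 = q → Module.finrank 𝔽 V = n →
      ∀ F : Set (RankLevel (fun X : Submodule 𝔽 V => Module.finrank 𝔽 X) k),
        setDegree (fun X : Submodule 𝔽 V => Module.finrank 𝔽 X) n k F = 1 →
        (∃ z : ℤ, ((qNumber q k : ℚ) / (qNumber q (Nat.gcd n k) : ℚ)) *
            degreeOneParameter (fun X : Submodule 𝔽 V => Module.finrank 𝔽 X) q n k F = z) ∧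
          (degreeOneParameter (fun X : Submodule 𝔽 V => Module.finrank 𝔽 X) q n k F).den *
            qNumber q (Nat.gcd n k) ∣ qNumber q k) := by
  refine ⟨?_, ?_⟩
  · rintro rfl V _ hn F h
    exact degreeOneParameter_integrality_finset F hn h
  · intro 𝔽 _ _ V _ _ _ hq hn F h
    subst hq
    exact degreeOneParameter_integrality_submodule hn F h
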